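/- Let $D\ge 1$, $\alpha_1,\dots,\alpha_{D+1}>0$ and $\lambda_1,\dots,\lambda_{D+1}\ge 0$. Let $(M_i,Y'_i)$, $i=1,\dots,D+1$, be independent pairs such that $M_i\sim\mathrm{Poisson}(\lambda_i/2)$ and $Y'_i\mid M_i\sim\chi^2_{2\alpha_i+2M_i}$ (so that $Y'_i$ has the non-central chi-squared distribution $\chi'^2_{2\alpha_i}(\lambda_i)$), and put $Y'^+=\sum_{i=1}^{D+1}Y'_i$. Denote by $\mathrm{MW}^{D+1}(\alpha^+,\underline\lambda)$, where $\alpha^+=\sum_{i=1}^{D+1}\alpha_i$, the conditional distribution of $(M_1,\dots,M_{D+1})$ given $Y'^+=1$ (which depends on the $\alpha_i$ only through $\alpha^+$), and by $\mathrm{CNcDir}^D(\underline\alpha,\underline\lambda)$ the conditional distribution of $(Y'_1/Y'^+,\dots,Y'_D/Y'^+)$ given $Y'^+=1$; here the conditional distribution given $Y'^+=1$ is the weak limit, as $\varepsilon\downarrow0$, of the conditional distributions given $|Y'^+-1|<\varepsilon$. Let $\underline N=(N_1,\dots,N_{D+1})\sim\mathrm{MW}^{D+1}(\alpha^+,\underline\lambda)$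 with $N^+=\sum_{i=1}^{D+1}N_i$, and let $Z'_1,\dots,Z'_{D+1}$ be random variables on the same probability space which, conditionally on $\underline N$, are independent with $Z'_i\mid\underline N\sim\chi^2_{2\alpha_i+2N_i}$. Put $Z'^+=\sum_{i=1}^{D+1}Z'_i$ and $\underline X''=(Z'_1/Z'^+,\dots,Z'_D/Z'^+)$. Then $\underline X''\sim\mathrm{CNcDir}^D(\underline\alpha,\underline\lambda)$, and $\underline X''$ and $Z'^+$ are conditionally independent given $N^+$, i.e. they are independent under $\Pr(\,\cdot\mid N^+=s)$ for every $s\in\mathbb N_0$ with $\Pr(N^+=s)>0$. -/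

import Mathlib

open MeasureTheory ProbabilityTheory Filter Topology
open scoped NNReal ENNReal BoundedContinuousFunction

/-- The (central) chi-squared distribution with `k > 0` degrees of freedom, that is the Gamma
distribution with shape `k / 2` and rate `1 / 2`. -/
noncomputable def chiSq (k : ℝ) : Measure ℝ := gammaMeasure (k / 2) (1 / 2)

/-- The kernel `m ↦ χ²_{g + 2 m}` from `ℕ` to `ℝ`. -/
noncomputable def chiSqKernel (g : ℝ) : Kernel ℕ ℝ :=
  Kernel.ofFunOfCountable fun m => chiSq (g + 2 * (m : ℝ))

/-- The joint law of `(M, Y')`, where `M ∼ Poisson(l / 2)` and `Y' | M ∼ χ²_{g + 2 M}`. -/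
noncomputable def poissonChiSq (g : ℝ) (l : ℝ≥0) : Measure (ℕ × ℝ) :=
  poissonMeasure (l / 2) ⊗ₘ chiSqKernel g

/-- The non-central chi-squared distribution `χ'²_g(l)` with `g > 0` degrees of freedom and
non-centrality `l ≥ 0`: the law of `Y'` when `M ∼ Poisson(l / 2)` and `Y' | M ∼ χ²_{g + 2 M}`. -/
noncomputable def ncChiSq (g : ℝ) (l : ℝ≥0) : Measure ℝ := (poissonChiSq g l).map Prod.snd

/-- `ν` is the conditional law of `X` given `Y = y`, for a real random variable `Y` for which
`{Y = y}` may be a null event: the probability measure that is the weak limit, as `ε ↓ 0`, of the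
laws of `X` under the elementary conditional probabilities given `|Y - y| < ε`.
Weak limits being unique, there is at most one such `ν` on a metric space. -/
def IsCondLawAt {Ω E : Type*} [MeasurableSpace Ω] [TopologicalSpace E] [MeasurableSpace E]
    (μ : Measure Ω) (X : Ω → E) (Y : Ω → ℝ) (y : ℝ) (ν : Measure E) : Prop :=
  IsProbabilityMeasure ν ∧
    ∀ f : E →ᵇ ℝ,
      Tendsto (fun ε : ℝ => ∫ ω, f (X ω) ∂(μ[|{ω | |Y ω - y| < ε}])) (𝓝[>] 0)
        (𝓝 (∫ x, f x ∂ν))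

/-- The first `D` of the `D + 1` proportions of `z` in its total:
`(z₁ / z⁺, …, z_D / z⁺)` with `z⁺ = z₁ + ⋯ + z_{D+1}`. -/
noncomputable def proportions {D : ℕ} (z : Fin (D + 1) → ℝ) : Fin D → ℝ :=
  fun i => z i.castSucc / ∑ j, z j

/-- `ν` is the `D`-variate Conditional Non-central Dirichlet distribution with shape parameters
`α` and non-centrality parameters `lam`: the conditional law of
`(Y'₁ / Y'⁺, …, Y'_D / Y'⁺)` given `Y'⁺ = 1`, where `Y'₁, …, Y'_{D+1}` are independent,
`Y'_i ∼ χ'²_{2 α_i}(lam_i)`, and `Y'⁺` is their sum. -/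
def IsCNcDir {D : ℕ} (α : Fin (D + 1) → ℝ) (lam : Fin (D + 1) → ℝ≥0)
    (ν : Measure (Fin D → ℝ)) : Prop :=
  IsCondLawAt (Measure.pi fun i => ncChiSq (2 * α i) (lam i))
    proportions (fun y => ∑ i, y i) 1 ν

/-- `ν` is the `(D + 1)`-variate Mixture Weight distribution: the conditional law of
`M = (M₁, …, M_{D+1})` given `Y'⁺ = 1`, where the pairs `(M_i, Y'_i)` are independent,
`M_i ∼ Poisson(lam_i / 2)`, `Y'_i | M_i ∼ χ²_{2 α_i + 2 M_i}`
(so that `Y'_i ∼ χ'²_{2 α_i}(lam_i)`), and `Y'⁺` is the sum of the `Y'_i`.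
This law depends on `α` only through `α⁺ = α₁ + ⋯ + α_{D+1}`. -/
def IsMW {D : ℕ} (α : Fin (D + 1) → ℝ) (lam : Fin (D + 1) → ℝ≥0)
    (ν : Measure (Fin (D + 1) → ℕ)) : Prop :=
  IsCondLawAt (Measure.pi fun i => poissonChiSq (2 * α i) (lam i))
    (fun p i => (p i).1) (fun p => ∑ i, (p i).2) 1 ν

/-- Conditional independence of `X` and `Y` given a discrete (`ℕ`-valued) random variable `S`:
`X` and `Y` are independent under `μ(· | S = s)` for each value `s` of positive probability. -/
def CondIndepGivenNat {Ω E F : Type*} [MeasurableSpace Ω] [MeasurableSpace E] [MeasurableSpace F]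
    (X : Ω → E) (Y : Ω → F) (S : Ω → ℕ) (μ : Measure Ω) : Prop :=
  ∀ s : ℕ, μ (S ⁻¹' {s}) ≠ 0 → IndepFun X Y (μ[|S ⁻¹' {s}])

/-! Everything rests on one fact about independent Gamma variables of common rate: their proportions
are independent of their total, whose law sees only the sum of the shapes
(`pi_gammaMeasure_proportions_inter_sum`). It is proved by moment generating functions: tilting by
`exp (t * total)` changes only the rate, and a change of rate is a rescaling, invisible to
proportions.

For the law of `X''`, let `h n` be the mean of `f (proportions)` given weights `n`. By independence
within each component, `f (proportions)` may be replaced by `h M` on any event determined by the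
total (`setIntegral_comp_eq_of_mixture`). So conditioning on `|Y'⁺ - 1| < ε` gives both the same
mean, and the limit defining the mixture weights yields `E h(N)`, which is `E f(X'')`.

For conditional independence, all components with `N⁺ = s` have the same law of the total, so it
factors out of the sum over them. -/

/-! ### Scaling and tilting of Gamma laws. -/

lemma chiSq_isProbabilityMeasure {k : ℝ} (hk : 0 < k) : IsProbabilityMeasure (chiSq k) :=
  isProbabilityMeasure_gammaMeasure (by positivity) (by norm_num)

lemma measurable_gammaPDF (a r : ℝ) : Measurable (gammaPDF a r) :=
  (measurable_gammaPDFReal a r).ennreal_ofReal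

/-- Scaling of the Gamma distribution. -/
lemma gammaMeasure_map_const_mul (a : ℝ) {r c : ℝ} (hr : 0 < r) (hc : 0 < c) :
    (gammaMeasure a (c * r)).map (c * ·) = gammaMeasure a r := by
  ext s hs
  have hm : Measurable fun x : ℝ => c * x := measurable_const_mul c
  rw [Measure.map_apply hm hs, gammaMeasure, gammaMeasure, withDensity_apply _ (hm hs),
    withDensity_apply _ hs]
  conv_rhs => rw [← Real.smul_map_volume_mul_left hc.ne']
  rw [Measure.restrict_smul, lintegral_smul_measure, ← lintegral_indicator hs,
    lintegral_map ((measurable_gammaPDF a r).indicator hs) hm, ← lintegral_indicator (hm hs),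
    smul_eq_mul, ← lintegral_const_mul _ (show Measurable fun x => s.indicator (gammaPDF a r) (c * x)
      from ((measurable_gammaPDF a r).indicator hs).comp hm)]
  refine lintegral_congr fun x => ?_
  by_cases hx : c * x ∈ s
  · rw [Set.indicator_of_mem (show x ∈ (fun x => c * x) ⁻¹' s from hx), Set.indicator_of_mem hx,
      gammaPDF, gammaPDF, ← ENNReal.ofReal_mul (abs_nonneg _), abs_of_pos hc]
    congr 1
    simp only [gammaPDFReal, mul_nonneg_iff_of_pos_left hc]
    split_ifs with h
    · rw [Real.mul_rpow hc.le hr.le, Real.mul_rpow hc.le h, Real.rpow_sub_one hc.ne']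
      field_simp
    · simp
  · rw [Set.indicator_of_notMem (show x ∉ (fun x => c * x) ⁻¹' s from hx),
      Set.indicator_of_notMem hx, mul_zero]

/-- Exponential tilting of the Gamma distribution. -/
lemma gammaMeasure_withDensity_exp {a r t : ℝ} (hr : 0 < r) (ht : t < r) :
    (gammaMeasure a r).withDensity (fun x => ENNReal.ofReal (Real.exp (t * x))) =
      ENNReal.ofReal ((r / (r - t)) ^ a) • gammaMeasure a (r - t) := by
  have ht' : 0 < r - t := sub_pos.2 ht
  have hp : 0 < (r - t) ^ a := Real.rpow_pos_of_pos ht' a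
  rw [gammaMeasure, gammaMeasure, ← withDensity_smul _ (measurable_gammaPDF a _),
    ← withDensity_mul _ (measurable_gammaPDF a r) (by fun_prop)]
  congr 1
  ext x
  simp only [Pi.mul_apply, Pi.smul_apply, smul_eq_mul, gammaPDF]
  rw [← ENNReal.ofReal_mul' (Real.exp_nonneg _),
    ← ENNReal.ofReal_mul (Real.rpow_nonneg (div_nonneg hr.le ht'.le) _)]
  congr 1
  simp only [gammaPDFReal]
  split_ifs with h
  · rw [Real.div_rpow hr.le ht'.le, show -((r - t) * x) = -(r * x) + t * x by ring, Real.exp_add]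
    field_simp
  · simp

/-! ### Product measures and products of Gamma laws. -/

section Pi

variable {ι : Type*} [Fintype ι]

lemma pi_smul {X : ι → Type*} [∀ i, MeasurableSpace (X i)] (c : ι → ℝ≥0∞) (hc : ∀ i, c i ≠ ∞)
    (ν : ∀ i, Measure (X i)) [∀ i, IsFiniteMeasure (ν i)] :
    Measure.pi (fun i => c i • ν i) = (∏ i, c i) • Measure.pi ν := by
  have (i : ι) : IsFiniteMeasure (c i • ν i) := Measure.smul_finite _ (hc i)
  refine Measure.pi_eq fun s _ => ?_
  simp [Measure.pi_pi, Finset.prod_mul_distrib]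

lemma lintegral_pi_prod {X : ι → Type*} [∀ i, MeasurableSpace (X i)]
    (ν : ∀ i, Measure (X i)) [∀ i, IsProbabilityMeasure (ν i)]
    {f : ∀ i, X i → ℝ≥0∞} (hf : ∀ i, Measurable (f i)) :
    ∫⁻ x, ∏ i, f i (x i) ∂Measure.pi ν = ∏ i, ∫⁻ x, f i x ∂ν i := by
  refine (lintegral_prod_eq_prod_lintegral_of_indepFun Finset.univ
    (fun i (x : ∀ i, X i) => f i (x i)) (iIndepFun_pi fun i => (hf i).aemeasurable)
    fun i => (hf i).comp (measurable_pi_apply i)).trans ?_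
  refine Finset.prod_congr rfl fun i _ => ?_
  classical
  rw [← lintegral_map (hf i) (measurable_pi_apply i), Measure.pi_map_eval]
  simp

lemma pi_withDensity {X : ι → Type*} [∀ i, MeasurableSpace (X i)]
    (ν : ∀ i, Measure (X i)) [∀ i, IsProbabilityMeasure (ν i)]
    {f : ∀ i, X i → ℝ≥0∞} (hf : ∀ i, Measurable (f i))
    [∀ i, SigmaFinite ((ν i).withDensity (f i))] :
    (Measure.pi ν).withDensity (fun x => ∏ i, f i (x i)) =
      Measure.pi fun i => (ν i).withDensity (f i) := by
  symm
  refine Measure.pi_eq fun s hs => ?_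
  rw [withDensity_apply _ (MeasurableSet.univ_pi hs), ← lintegral_indicator (.univ_pi hs)]
  simp_rw [withDensity_apply _ (hs _), ← lintegral_indicator (hs _)]
  rw [← lintegral_pi_prod ν fun i => (hf i).indicator (hs i)]
  refine lintegral_congr fun x => ?_
  by_cases hx : x ∈ Set.univ.pi s
  · rw [Set.indicator_of_mem hx]
    exact Finset.prod_congr rfl fun i _ => (Set.indicator_of_mem (hx i trivial) _).symm
  · rw [Set.indicator_of_notMem hx]
    obtain ⟨i, hi⟩ : ∃ i, x i ∉ s i := by simpa [Set.mem_pi] using hx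
    exact (Finset.prod_eq_zero (Finset.mem_univ i) (Set.indicator_of_notMem hi _)).symm

lemma pi_gammaMeasure_withDensity_exp_sum {a : ι → ℝ} (ha : ∀ i, 0 < a i) {r t : ℝ} (hr : 0 < r)
    (ht : t < r) :
    (Measure.pi fun i => gammaMeasure (a i) r).withDensity
        (fun x => ENNReal.ofReal (Real.exp (t * ∑ i, x i))) =
      ENNReal.ofReal ((r / (r - t)) ^ ∑ i, a i) • Measure.pi fun i => gammaMeasure (a i) (r - t) := by
  have ht' : 0 < r - t := sub_pos.2 ht
  have (i : ι) := isProbabilityMeasure_gammaMeasure (ha i) hr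
  have (i : ι) := isProbabilityMeasure_gammaMeasure (ha i) ht'
  have (i : ι) : IsFiniteMeasure
      (ENNReal.ofReal ((r / (r - t)) ^ a i) • gammaMeasure (a i) (r - t)) :=
    Measure.smul_finite _ ENNReal.ofReal_ne_top
  have (i : ι) : IsFiniteMeasure ((gammaMeasure (a i) r).withDensity
      (fun x => ENNReal.ofReal (Real.exp (t * x)))) := by
    rw [gammaMeasure_withDensity_exp hr ht]; infer_instance
  have h := pi_withDensity (fun i => gammaMeasure (a i) r)
    (f := fun _ x => ENNReal.ofReal (Real.exp (t * x))) (fun i => by fun_prop)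
  simp_rw [gammaMeasure_withDensity_exp hr ht] at h
  rw [pi_smul _ (fun i => ENNReal.ofReal_ne_top),
    ← ENNReal.ofReal_prod_of_nonneg fun i _ => by positivity,
    ← Real.rpow_sum_of_pos (by positivity)] at h
  rw [← h]
  congr 1
  ext x
  rw [Finset.mul_sum, Real.exp_sum, ENNReal.ofReal_prod_of_nonneg fun i _ => by positivity]

lemma pi_gammaMeasure_map_const_smul {a : ι → ℝ} (ha : ∀ i, 0 < a i) {r c : ℝ} (hr : 0 < r)
    (hc : 0 < c) :
    (Measure.pi fun i => gammaMeasure (a i) (c * r)).map (fun x => c • x) =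
      Measure.pi fun i => gammaMeasure (a i) r := by
  have (i : ι) := isProbabilityMeasure_gammaMeasure (ha i) hr
  have (i : ι) := isProbabilityMeasure_gammaMeasure (ha i) (mul_pos hc hr)
  have (i : ι) : SigmaFinite ((gammaMeasure (a i) (c * r)).map (c * ·)) := by
    rw [gammaMeasure_map_const_mul _ hr hc]; infer_instance
  have h := Measure.pi_map_pi (μ := fun i => gammaMeasure (a i) (c * r))
    (f := fun _ x => c * x) fun i => (measurable_const_mul c).aemeasurable
  simp_rw [gammaMeasure_map_const_mul _ hr hc] at h
  exact h

end Pi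

/-! ### Independence of proportions and total. -/

lemma measurable_proportions {D : ℕ} : Measurable (proportions (D := D)) := by
  unfold proportions
  fun_prop

lemma proportions_smul {D : ℕ} {c : ℝ} (hc : c ≠ 0) (z : Fin (D + 1) → ℝ) :
    proportions (c • z) = proportions z := by
  ext i
  simp only [proportions, Pi.smul_apply, smul_eq_mul, ← Finset.mul_sum]
  exact mul_div_mul_left _ _ hc

/-- Finite measures on the line whose moment generating functions are finite and agree near `0`
are equal. -/
lemma measure_ext_of_mgf_eqOn {ν ν' : Measure ℝ} [IsFiniteMeasure ν] [IsFiniteMeasure ν']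
    {s : Set ℝ} (hs : IsOpen s) (hconv : Convex ℝ s) (h0 : 0 ∈ s)
    (hν : s ⊆ integrableExpSet id ν) (hν' : s ⊆ integrableExpSet id ν')
    (h : ∀ t ∈ s, mgf id ν t = mgf id ν' t) : ν = ν' := by
  -- Identity theorem on a vertical strip, which contains the imaginary axis and so reaches the
  -- characteristic functions.
  have key : Set.EqOn (complexMGF id ν) (complexMGF id ν') {z | z.re ∈ s} := by
    refine AnalyticOnNhd.eqOn_of_preconnected_of_frequently_eq
      (analyticOnNhd_complexMGF.mono fun z hz => interior_maximal hν hs hz)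
      (analyticOnNhd_complexMGF.mono fun z hz => interior_maximal hν' hs hz)
      (hconv.linear_preimage Complex.reLm).isPreconnected (z₀ := ((0 : ℝ) : ℂ)) (by simpa) ?_
    have h_real : ∃ᶠ x : ℝ in 𝓝[≠] 0, complexMGF id ν x = complexMGF id ν' x := by
      refine Eventually.frequently ?_
      filter_upwards [nhdsWithin_le_nhds (hs.mem_nhds h0)] with x hx
      rw [complexMGF_ofReal, complexMGF_ofReal, h x hx]
    have ht : Tendsto (fun x : ℝ => (x : ℂ)) (𝓝[≠] 0) (𝓝[≠] ((0 : ℝ) : ℂ)) := by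
      refine tendsto_nhdsWithin_iff.2 ⟨(Complex.continuous_ofReal.tendsto 0).mono_left
        nhdsWithin_le_nhds, ?_⟩
      filter_upwards [self_mem_nhdsWithin] with x hx
      simpa using hx
    exact ht.frequently h_real
  refine Measure.ext_of_charFun (funext fun t => ?_)
  have := key (show ((t : ℂ) * Complex.I).re ∈ s by simpa)
  simp only [complexMGF, id] at this
  rw [charFun_apply_real, charFun_apply_real]
  convert this using 3 <;> (congr 1; ring)

/-- Tilting lowers the rate to `r - t`; multiplying by `(r - t) / r` restores rate `r` and leaves
the proportions fixed. -/
lemma setLIntegral_proportions_exp_sum {D : ℕ} {a : Fin (D + 1) → ℝ} (ha : ∀ i, 0 < a i)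
    {r t : ℝ} (hr : 0 < r) (ht : t < r) {A : Set (Fin D → ℝ)} (hA : MeasurableSet A) :
    ∫⁻ x in proportions ⁻¹' A, ENNReal.ofReal (Real.exp (t * ∑ i, x i))
        ∂Measure.pi (fun i => gammaMeasure (a i) r) =
      ENNReal.ofReal ((r / (r - t)) ^ ∑ i, a i) *
        Measure.pi (fun i => gammaMeasure (a i) r) (proportions ⁻¹' A) := by
  have ht' : 0 < r - t := sub_pos.2 ht
  have hc : 0 < (r - t) / r := by positivity
  rw [← withDensity_apply _ (measurable_proportions hA), pi_gammaMeasure_withDensity_exp_sum ha hr ht,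
    Measure.smul_apply, smul_eq_mul]
  congr 1
  conv_rhs => rw [← pi_gammaMeasure_map_const_smul ha hr hc]
  rw [Measure.map_apply (measurable_const_smul _) (measurable_proportions hA),
    div_mul_cancel₀ _ hr.ne']
  congr 1
  ext x
  simp [proportions_smul hc.ne']

/-- If `X` has independent Gamma coordinates with a common rate, then the proportions of `X` are
independent of the total, and the law of the total depends only on the sum of the shapes. -/
lemma pi_gammaMeasure_proportions_inter_sum {D : ℕ} {a b : Fin (D + 1) → ℝ}
    (ha : ∀ i, 0 < a i) (hb : ∀ i, 0 < b i) (hab : ∑ i, a i = ∑ i, b i) {r : ℝ} (hr : 0 < r)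
    {A : Set (Fin D → ℝ)} (hA : MeasurableSet A) {B : Set ℝ} (hB : MeasurableSet B) :
    Measure.pi (fun i => gammaMeasure (a i) r)
        (proportions ⁻¹' A ∩ (fun x => ∑ i, x i) ⁻¹' B) =
      Measure.pi (fun i => gammaMeasure (a i) r) (proportions ⁻¹' A) *
        Measure.pi (fun i => gammaMeasure (b i) r) ((fun x => ∑ i, x i) ⁻¹' B) := by
  have (i : Fin (D + 1)) := isProbabilityMeasure_gammaMeasure (ha i) hr
  have (i : Fin (D + 1)) := isProbabilityMeasure_gammaMeasure (hb i) hr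
  have hS : Measurable fun x : Fin (D + 1) → ℝ => ∑ i, x i := by fun_prop
  set πa := Measure.pi fun i => gammaMeasure (a i) r
  set πb := Measure.pi fun i => gammaMeasure (b i) r
  set c := πa (proportions ⁻¹' A)
  have hc : c ≠ ∞ := measure_ne_top _ _
  -- The claim is `ν B = ν' B`; both measures have the same exponential moments for `t < r`.
  set ν := (πa.restrict (proportions ⁻¹' A)).map fun x => ∑ i, x i with hν
  set ν' := c • πb.map fun x => ∑ i, x i with hν'
  have : IsFiniteMeasure ν' := Measure.smul_finite _ hc
  have hL (t : ℝ) (ht : t ∈ Set.Iio r) : ∫⁻ x, ENNReal.ofReal (Real.exp (t * x)) ∂ν =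
      ENNReal.ofReal ((r / (r - t)) ^ ∑ i, a i) * c := by
    rw [hν, lintegral_map (by fun_prop) hS, setLIntegral_proportions_exp_sum ha hr ht hA]
  have hL' (t : ℝ) (ht : t ∈ Set.Iio r) : ∫⁻ x, ENNReal.ofReal (Real.exp (t * x)) ∂ν' =
      ENNReal.ofReal ((r / (r - t)) ^ ∑ i, a i) * c := by
    have := setLIntegral_proportions_exp_sum hb hr ht MeasurableSet.univ
    rw [Set.preimage_univ, Measure.restrict_univ, measure_univ, mul_one] at this
    rw [hν', lintegral_smul_measure, lintegral_map (by fun_prop) hS, this, hab, smul_eq_mul,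
      mul_comm]
  have hint {m : Measure ℝ} {t : ℝ} (h : ∫⁻ x, ENNReal.ofReal (Real.exp (t * x)) ∂m =
      ENNReal.ofReal ((r / (r - t)) ^ ∑ i, a i) * c) : t ∈ integrableExpSet id m := by
    refine ⟨by fun_prop, ?_⟩
    rw [hasFiniteIntegral_iff_ofReal (ae_of_all _ fun x => (Real.exp_pos _).le)]
    simp only [id]
    rw [h]
    exact ENNReal.mul_lt_top ENNReal.ofReal_lt_top hc.lt_top
  have heq : ν = ν' := by
    refine measure_ext_of_mgf_eqOn isOpen_Iio (convex_Iio r) hr (fun t ht => hint (hL t ht))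
      (fun t ht => hint (hL' t ht)) fun t ht => ?_
    rw [mgf, mgf, integral_eq_lintegral_of_nonneg_ae (ae_of_all _ fun x => (Real.exp_pos _).le)
      (by fun_prop), integral_eq_lintegral_of_nonneg_ae (ae_of_all _ fun x => (Real.exp_pos _).le)
      (by fun_prop)]
    simp only [id]
    rw [hL t ht, hL' t ht]
  have := congrArg (fun m : Measure ℝ => m B) heq
  simp only [hν, hν'] at this
  rwa [Measure.map_apply hS hB, Measure.restrict_apply (hS hB), Measure.smul_apply,
    Measure.map_apply hS hB, smul_eq_mul, Set.inter_comm] at this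

/-! ### Mixtures: the hypothesis `h` says that `Z` has law `κ n` given `N = n`, without dividing by
a possibly null weight. -/

lemma measure_inter_fiber_of_mixture {Ω I E : Type*} [MeasurableSpace Ω] [MeasurableSpace E]
    {μ : Measure Ω} {N : Ω → I} {Z : Ω → E} {κ : I → Measure E} (hZ : Measurable Z)
    (h : ∀ n, (μ.restrict (N ⁻¹' {n})).map Z = μ (N ⁻¹' {n}) • κ n) (n : I)
    {A : Set E} (hA : MeasurableSet A) :
    μ (Z ⁻¹' A ∩ N ⁻¹' {n}) = μ (N ⁻¹' {n}) * κ n A := by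
  have := congrArg (fun m : Measure E => m A) (h n)
  rwa [Measure.map_apply hZ hA, Measure.restrict_apply (hZ hA), Measure.smul_apply,
    smul_eq_mul] at this

section Mixture

variable {Ω I E F G : Type*} [MeasurableSpace Ω] [MeasurableSpace I] [Countable I]
  [MeasurableSingletonClass I] [MeasurableSpace E] [MeasurableSpace F] [MeasurableSpace G]
  {μ : Measure Ω} {N : Ω → I} {Z : Ω → E} {κ : I → Measure E}

lemma measure_eq_tsum_of_mixture (hN : Measurable N) (hZ : Measurable Z)
    (h : ∀ n, (μ.restrict (N ⁻¹' {n})).map Z = μ (N ⁻¹' {n}) • κ n) (T : Set I)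
    {A : Set E} (hA : MeasurableSet A) :
    μ (N ⁻¹' T ∩ Z ⁻¹' A) = ∑' n : T, μ (N ⁻¹' {n.1}) * κ n A := by
  have hU : N ⁻¹' T ∩ Z ⁻¹' A = ⋃ n : T, Z ⁻¹' A ∩ N ⁻¹' {n.1} := by
    ext ω
    simp [and_comm]
  rw [hU, measure_iUnion _ fun n => (hZ hA).inter (hN (measurableSet_singleton _))]
  · exact tsum_congr fun n => measure_inter_fiber_of_mixture hZ h n hA
  · intro m n hmn
    refine Set.disjoint_left.2 fun ω hm hn => hmn (Subtype.ext ?_)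
    exact (show N ω = m from hm.2).symm.trans hn.2

/-- In a mixture whose components make `P` and `S` independent, `f (P Z)` may be replaced by its
component mean on events determined by `S`. -/
lemma setIntegral_comp_eq_of_mixture [IsFiniteMeasure μ] [∀ n, IsProbabilityMeasure (κ n)]
    (hN : Measurable N) (hZ : Measurable Z)
    (h : ∀ n, (μ.restrict (N ⁻¹' {n})).map Z = μ (N ⁻¹' {n}) • κ n)
    {P : E → F} {S : E → G} (hP : Measurable P) (hS : Measurable S)
    (hind : ∀ n, IndepFun P S (κ n)) {f : F → ℝ} (hf : Measurable f) {C : ℝ}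
    (hC : ∀ x, ‖f x‖ ≤ C) {B : Set G} (hB : MeasurableSet B) :
    ∫ ω in (fun ω => S (Z ω)) ⁻¹' B, f (P (Z ω)) ∂μ =
      ∫ ω in (fun ω => S (Z ω)) ⁻¹' B, (∫ z, f (P z) ∂κ (N ω)) ∂μ := by
  have hSB : MeasurableSet ((fun ω => S (Z ω)) ⁻¹' B) := hS.comp hZ hB
  have hm : Measurable fun n => ∫ z, f (P z) ∂κ n := measurable_of_countable _
  have hbd (n : I) : ‖∫ z, f (P z) ∂κ n‖ ≤ C := by
    simpa using norm_integral_le_of_norm_le_const (μ := κ n) (ae_of_all _ fun z => hC (P z))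
  have hi1 : Integrable (fun ω => f (P (Z ω))) μ :=
    .of_bound (hf.comp (hP.comp hZ)).aestronglyMeasurable C (ae_of_all _ fun ω => hC _)
  have hi2 : Integrable (fun ω => ∫ z, f (P z) ∂κ (N ω)) μ :=
    .of_bound (hm.comp hN).aestronglyMeasurable C (ae_of_all _ fun ω => hbd _)
  have hU : (fun ω => S (Z ω)) ⁻¹' B = ⋃ n, (fun ω => S (Z ω)) ⁻¹' B ∩ N ⁻¹' {n} := by
    ext ω
    simp
  have hM (n : I) : MeasurableSet ((fun ω => S (Z ω)) ⁻¹' B ∩ N ⁻¹' {n}) :=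
    hSB.inter (hN (measurableSet_singleton n))
  have hd : Pairwise (Function.onFun Disjoint fun n => (fun ω => S (Z ω)) ⁻¹' B ∩ N ⁻¹' {n}) := by
    intro m n hmn
    refine Set.disjoint_left.2 fun ω hm hn => hmn ?_
    exact (show N ω = m from hm.2).symm.trans hn.2
  rw [hU, integral_iUnion hM hd hi1.integrableOn, integral_iUnion hM hd hi2.integrableOn]
  refine tsum_congr fun n => ?_
  have hR : ∫ ω in (fun ω => S (Z ω)) ⁻¹' B ∩ N ⁻¹' {n}, (∫ z, f (P z) ∂κ (N ω)) ∂μ =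
      ∫ ω in (fun ω => S (Z ω)) ⁻¹' B ∩ N ⁻¹' {n}, (∫ z, f (P z) ∂κ n) ∂μ :=
    setIntegral_congr_fun (hM n) fun ω hω => by rw [show N ω = n from hω.2]
  -- Independence applied to `f ∘ P` and the indicator of `B` at `S`.
  have hI : ∫ z in S ⁻¹' B, f (P z) ∂κ n = (κ n).real (S ⁻¹' B) * ∫ z, f (P z) ∂κ n := by
    have h1 := (hind n).integral_fun_comp_mul_comp (f := f)
      (g := B.indicator fun _ => (1 : ℝ)) hP.aemeasurable hS.aemeasurable
      hf.aestronglyMeasurable (measurable_const.indicator hB).aestronglyMeasurable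
    have h2 : (fun z => B.indicator (fun _ => (1 : ℝ)) (S z)) = (S ⁻¹' B).indicator 1 := rfl
    rw [h2, integral_indicator_one (hS hB), mul_comm] at h1
    rw [← h1, ← integral_indicator (hS hB)]
    refine integral_congr_ae (ae_of_all _ fun z => ?_)
    by_cases hz : S z ∈ B <;> simp [hz]
  have hL : ∫ ω in (fun ω => S (Z ω)) ⁻¹' B ∩ N ⁻¹' {n}, f (P (Z ω)) ∂μ =
      μ.real (N ⁻¹' {n}) * ∫ z in S ⁻¹' B, f (P z) ∂κ n := by
    rw [← Measure.restrict_restrict hSB, ← smul_eq_mul, measureReal_def, ← integral_smul_measure,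
      ← Measure.restrict_smul, ← h n,
      setIntegral_map (hS hB)
        (show Measurable fun z => f (P z) from hf.comp hP).aestronglyMeasurable hZ.aemeasurable]
    rfl
  rw [hR, hL, hI, setIntegral_const, measureReal_def μ (_ ∩ _),
    show (fun ω => S (Z ω)) ⁻¹' B = Z ⁻¹' (S ⁻¹' B) from rfl,
    measure_inter_fiber_of_mixture hZ h n (hS hB), ENNReal.toReal_mul, smul_eq_mul, mul_assoc]
  rfl

end Mixture

/-! ### Non-central chi-squared laws as Poisson mixtures. -/

lemma chiSqKernel_isMarkovKernel {g : ℝ} (hg : 0 < g) : IsMarkovKernel (chiSqKernel g) :=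
  ⟨fun m => chiSq_isProbabilityMeasure (k := g + 2 * (m : ℝ)) (by positivity)⟩

lemma poissonChiSq_isProbabilityMeasure {g : ℝ} (hg : 0 < g) (l : ℝ≥0) :
    IsProbabilityMeasure (poissonChiSq g l) := by
  have := chiSqKernel_isMarkovKernel hg
  unfold poissonChiSq
  infer_instance

lemma poissonChiSq_restrict_map_snd {g : ℝ} (hg : 0 < g) (l : ℝ≥0) (m : ℕ) :
    ((poissonChiSq g l).restrict ({m} ×ˢ Set.univ)).map Prod.snd =
      poissonMeasure (l / 2) {m} • chiSq (g + 2 * (m : ℝ)) := by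
  have := chiSqKernel_isMarkovKernel hg
  ext s hs
  rw [Measure.map_apply measurable_snd hs, Measure.restrict_apply (measurable_snd hs),
    show Prod.snd ⁻¹' s ∩ {m} ×ˢ Set.univ = ({m} : Set ℕ) ×ˢ s by ext ⟨a, b⟩; simp [and_comm],
    poissonChiSq, Measure.compProd_apply_prod (measurableSet_singleton m) hs,
    lintegral_singleton, mul_comm]
  rfl

section

variable {ι : Type*} [Fintype ι] {g : ι → ℝ}

lemma pi_poissonChiSq_restrict_map (hg : ∀ i, 0 < g i) (l : ι → ℝ≥0) (n : ι → ℕ) :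
    ((Measure.pi fun i => poissonChiSq (g i) (l i)).restrict ((fun p i => (p i).1) ⁻¹' {n})).map
        (fun p i => (p i).2) =
      Measure.pi (fun i => poissonChiSq (g i) (l i)) ((fun p i => (p i).1) ⁻¹' {n}) •
        Measure.pi fun i => chiSq (g i + 2 * (n i : ℝ)) := by
  have (i : ι) := poissonChiSq_isProbabilityMeasure (hg i) (l i)
  have (i : ι) : IsProbabilityMeasure (chiSq (g i + 2 * (n i : ℝ))) :=
    chiSq_isProbabilityMeasure (by have := hg i; positivity)
  have hset : ((fun (p : ι → ℕ × ℝ) i => (p i).1) ⁻¹' {n}) =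
      Set.univ.pi fun i => ({n i} : Set ℕ) ×ˢ (Set.univ : Set ℝ) := by
    ext p
    simp [funext_iff, Set.mem_pi]
  have h1 : (Measure.pi fun i => poissonChiSq (g i) (l i)).restrict
      (Set.univ.pi fun i => ({n i} : Set ℕ) ×ˢ (Set.univ : Set ℝ)) =
      Measure.pi fun i => (poissonChiSq (g i) (l i)).restrict ({n i} ×ˢ Set.univ) :=
    Measure.restrict_pi_pi _ _
  have hsf (i : ι) : SigmaFinite
      (((poissonChiSq (g i) (l i)).restrict ({n i} ×ˢ Set.univ)).map Prod.snd) :=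
    inferInstance
  have h2 : (Measure.pi fun i => (poissonChiSq (g i) (l i)).restrict ({n i} ×ˢ Set.univ)).map
      (fun p i => (p i).2) =
      Measure.pi fun i => ((poissonChiSq (g i) (l i)).restrict ({n i} ×ˢ Set.univ)).map Prod.snd :=
    Measure.pi_map_pi (μ := fun i => (poissonChiSq (g i) (l i)).restrict ({n i} ×ˢ Set.univ))
      (f := fun _ => Prod.snd) fun i => measurable_snd.aemeasurable
  have h3 : ((Measure.pi fun i => poissonChiSq (g i) (l i)).restrict
      ((fun p i => (p i).1) ⁻¹' {n})).map (fun p i => (p i).2) =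
      (∏ i, poissonMeasure (l i / 2) {n i}) • Measure.pi fun i => chiSq (g i + 2 * (n i : ℝ)) := by
    rw [hset, h1, h2]
    simp_rw [poissonChiSq_restrict_map_snd (hg _)]
    exact pi_smul _ (fun i => measure_ne_top _ _) _
  rw [h3]
  congr 1
  -- Comparing total masses identifies the product of Poisson weights with the mass of the fiber.
  have := congrArg (fun m => m Set.univ) h3
  simp only [Measure.smul_apply, measure_univ, smul_eq_mul, mul_one] at this
  rw [Measure.map_apply (by fun_prop) .univ, Measure.restrict_apply (by measurability)] at this
  simpa using this.symm

lemma pi_ncChiSq_eq_map (hg : ∀ i, 0 < g i) (l : ι → ℝ≥0) :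
    (Measure.pi fun i => ncChiSq (g i) (l i)) =
      (Measure.pi fun i => poissonChiSq (g i) (l i)).map fun p i => (p i).2 := by
  have (i : ι) := poissonChiSq_isProbabilityMeasure (hg i) (l i)
  have (i : ι) : SigmaFinite ((poissonChiSq (g i) (l i)).map Prod.snd) := inferInstance
  exact (Measure.pi_map_pi (μ := fun i => poissonChiSq (g i) (l i)) (f := fun _ => Prod.snd) fun i => measurable_snd.aemeasurable).symm

end

lemma pi_chiSq_proportions_inter_sum {D : ℕ} {a b : Fin (D + 1) → ℝ}
    (ha : ∀ i, 0 < a i) (hb : ∀ i, 0 < b i) (hab : ∑ i, a i = ∑ i, b i)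
    {A : Set (Fin D → ℝ)} (hA : MeasurableSet A) {B : Set ℝ} (hB : MeasurableSet B) :
    Measure.pi (fun i => chiSq (a i)) (proportions ⁻¹' A ∩ (fun x => ∑ i, x i) ⁻¹' B) =
      Measure.pi (fun i => chiSq (a i)) (proportions ⁻¹' A) *
        Measure.pi (fun i => chiSq (b i)) ((fun x => ∑ i, x i) ⁻¹' B) :=
  pi_gammaMeasure_proportions_inter_sum (fun i => half_pos (ha i)) (fun i => half_pos (hb i))
    (by simp_rw [← Finset.sum_div, hab]) (by norm_num) hA hB

/-! ### The main theorem. -/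

theorem mainTheorem8 {Ω : Type*} [MeasurableSpace Ω] (μ : Measure Ω) [IsProbabilityMeasure μ]
    (D : ℕ) (hD : 1 ≤ D)
    (α : Fin (D + 1) → ℝ) (hα : ∀ i, 0 < α i) (lam : Fin (D + 1) → ℝ≥0)
    (N : Ω → Fin (D + 1) → ℕ) (hN : Measurable N)
    (Z : Ω → Fin (D + 1) → ℝ) (hZ : Measurable Z)
    (hNlaw : IsMW α lam (μ.map N))
    (hZlaw : ∀ n : Fin (D + 1) → ℕ, μ (N ⁻¹' {n}) ≠ 0 →
      HasLaw Z (Measure.pi fun i => chiSq (2 * α i + 2 * (n i : ℝ))) (μ[|N ⁻¹' {n}])) :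
    IsCNcDir α lam (μ.map fun ω => proportions (Z ω)) ∧
      CondIndepGivenNat (fun ω => proportions (Z ω)) (fun ω => ∑ i, Z ω i)
        (fun ω => ∑ i, N ω i) μ := by
  have hg (i : Fin (D + 1)) : 0 < 2 * α i := by have := hα i; positivity
  have hgn (n : Fin (D + 1) → ℕ) (i : Fin (D + 1)) : 0 < 2 * α i + 2 * (n i : ℝ) := by
    have := hg i
    positivity
  set κ : (Fin (D + 1) → ℕ) → Measure (Fin (D + 1) → ℝ) :=
    fun n => Measure.pi fun i => chiSq (2 * α i + 2 * (n i : ℝ)) with hκ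
  have hκp (n : Fin (D + 1) → ℕ) : IsProbabilityMeasure (κ n) := by
    have (i : Fin (D + 1)) := chiSq_isProbabilityMeasure (hgn n i)
    simp only [hκ]
    infer_instance
  have hmix (n : Fin (D + 1) → ℕ) :
      (μ.restrict (N ⁻¹' {n})).map Z = μ (N ⁻¹' {n}) • κ n := by
    by_cases h0 : μ (N ⁻¹' {n}) = 0
    · rw [Measure.restrict_eq_zero.2 h0, h0, Measure.map_zero, zero_smul]
    · rw [show κ n = _ from (hZlaw n h0).map_eq.symm, ProbabilityTheory.cond, Measure.map_smul, smul_smul,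
        ENNReal.mul_inv_cancel h0 (measure_ne_top _ _), one_smul]
  have hP : Measurable (proportions (D := D)) := measurable_proportions
  have hS : Measurable fun x : Fin (D + 1) → ℝ => ∑ i, x i := by fun_prop
  have hind (n : Fin (D + 1) → ℕ) : IndepFun proportions (fun x => ∑ i, x i) (κ n) :=
    indepFun_iff_measure_inter_preimage_eq_mul.2 fun A B hA hB =>
      pi_chiSq_proportions_inter_sum (hgn n) (hgn n) rfl hA hB
  refine ⟨⟨Measure.isProbabilityMeasure_map (hP.comp hZ).aemeasurable, fun f => ?_⟩, fun s hs => ?_⟩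
  · have (i : Fin (D + 1)) := poissonChiSq_isProbabilityMeasure (hg i) (lam i)
    have hM : Measurable fun (p : Fin (D + 1) → ℕ × ℝ) i => (p i).1 := by fun_prop
    have hY : Measurable fun (p : Fin (D + 1) → ℕ × ℝ) i => (p i).2 := by fun_prop
    have hfm : Measurable f := f.continuous.measurable
    have hbd (n : Fin (D + 1) → ℕ) : ‖∫ z, f (proportions z) ∂κ n‖ ≤ ‖f‖ := by
      simpa using norm_integral_le_of_norm_le_const (μ := κ n)
        (ae_of_all _ fun z => f.norm_coe_le_norm (proportions z))
    -- The index space is discrete, so a bounded `h` is an admissible test function for the weak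
    -- limit.
    let h : (Fin (D + 1) → ℕ) →ᵇ ℝ :=
      BoundedContinuousFunction.ofNormedAddCommGroup (fun n => ∫ z, f (proportions z) ∂κ n)
        continuous_of_discreteTopology ‖f‖ hbd
    have hlim := hNlaw.2 h
    have htot := setIntegral_comp_eq_of_mixture hN hZ hmix hP hS hind hfm
      f.norm_coe_le_norm MeasurableSet.univ
    rw [Set.preimage_univ, Measure.restrict_univ] at htot
    rw [integral_map hN.aemeasurable (measurable_of_countable _).aestronglyMeasurable] at hlim
    rw [integral_map (show Measurable fun ω => proportions (Z ω) from hP.comp hZ).aemeasurable hfm.aestronglyMeasurable, htot]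
    -- The two conditional means agree for each `ε`, not only in the limit.
    refine hlim.congr fun ε => ?_
    have hB : MeasurableSet {y : ℝ | |y - 1| < ε} := measurableSet_lt (by fun_prop) (by fun_prop)
    have hSB : MeasurableSet {y : Fin (D + 1) → ℝ | |∑ i, y i - 1| < ε} := hS hB
    have hloc := setIntegral_comp_eq_of_mixture hM hY
      (pi_poissonChiSq_restrict_map hg lam) hP hS hind hfm f.norm_coe_le_norm hB
    rw [pi_ncChiSq_eq_map hg lam, ProbabilityTheory.cond,
      ProbabilityTheory.cond, integral_smul_measure, integral_smul_measure,
      Measure.map_apply hY hSB]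
    rw [setIntegral_map hSB
      (show Measurable fun z => f (proportions z) from hfm.comp hP).aestronglyMeasurable hY.aemeasurable]
    congr 1
    exact hloc.symm
  · have hT : (fun ω => ∑ i, N ω i) ⁻¹' {s} = N ⁻¹' {n | ∑ i, n i = s} := rfl
    have hTm : MeasurableSet (N ⁻¹' {n | ∑ i, n i = s}) := hN (Set.to_countable _).measurableSet
    rw [hT] at hs ⊢
    -- Any representative with total `s` would do.
    let n₀ : Fin (D + 1) → ℕ := Pi.single 0 s
    have key {A : Set (Fin D → ℝ)} (hA : MeasurableSet A) {B : Set ℝ} (hB : MeasurableSet B) :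
        μ (N ⁻¹' {n | ∑ i, n i = s} ∩
          Z ⁻¹' (proportions ⁻¹' A ∩ (fun x => ∑ i, x i) ⁻¹' B)) =
        μ (N ⁻¹' {n | ∑ i, n i = s} ∩ Z ⁻¹' (proportions ⁻¹' A)) *
          κ n₀ ((fun x => ∑ i, x i) ⁻¹' B) := by
      rw [measure_eq_tsum_of_mixture hN hZ hmix _ ((hP hA).inter (hS hB)),
        measure_eq_tsum_of_mixture hN hZ hmix _ (hP hA), ← ENNReal.tsum_mul_right]
      refine tsum_congr fun n => ?_
      have hsum : ∑ i, (2 * α i + 2 * (n.1 i : ℝ)) = ∑ i, (2 * α i + 2 * (n₀ i : ℝ)) := by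
        have h1 : ∑ i, n.1 i = ∑ i, n₀ i := by
          rw [show ∑ i, n.1 i = s from n.2]
          simp [n₀]
        simp only [Finset.sum_add_distrib, ← Finset.mul_sum, ← Nat.cast_sum, h1]
      rw [mul_assoc, ← pi_chiSq_proportions_inter_sum (hgn n.1) (hgn n₀) hsum hA hB]
    refine indepFun_iff_measure_inter_preimage_eq_mul.2 fun A B hA hB => ?_
    have hAB := key hA hB
    -- Taking `A = univ` shows that `κ n₀` gives the law of the total given `N⁺ = s`.
    have hBu := key MeasurableSet.univ hB
    rw [Set.preimage_univ, Set.univ_inter, Set.preimage_univ, Set.inter_univ] at hBu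
    rw [cond_apply hTm, cond_apply hTm, cond_apply hTm]
    change _ * μ (_ ∩ Z ⁻¹' (proportions ⁻¹' A ∩ (fun x => ∑ i, x i) ⁻¹' B)) =
      _ * μ (_ ∩ Z ⁻¹' (proportions ⁻¹' A)) * (_ * μ (_ ∩ Z ⁻¹' ((fun x => ∑ i, x i) ⁻¹' B)))
    rw [hAB, hBu, ← mul_assoc (μ (N ⁻¹' {n | ∑ i, n i = s}))⁻¹ (μ (N ⁻¹' {n | ∑ i, n i = s})),
      ENNReal.inv_mul_cancel hs (measure_ne_top _ _), one_mul, mul_assoc]
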